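/- Let $\mu=\dfrac{59729}{19885499729}$ and $c=\dfrac{149896229}{10}\sqrt{\dfrac{1495978707}{3317816087784734}}\approx 10065.3$ (the Earth–Sun values). For $(\xi,\eta)\in\mathbb R^2$ put $\rho=\sqrt{\xi^2+\eta^2}$, $\rho_1=\sqrt{(\xi+\mu)^2+\eta^2}$, $\rho_2=\sqrt{(\xi+\mu-1)^2+\eta^2}$, and let $$w_0=\tfrac12(\xi^2+\eta^2)+\frac{1-\mu}{\rho_1}+\frac{\mu}{\rho_2},\qquad Q=\dot\xi^2+\dot\eta^2+2(\dot\eta\,\xi-\dot\xi\,\eta)+\rho^2,$$ $$\begin{aligned}w_1={}&-\tfrac32\bigl(1-\tfrac13\mu(1-\mu)\bigr)\rho^2+\tfrac18Q^2+\tfrac32\Bigl(\frac{1-\mu}{\rho_1}+\frac{\mu}{\rho_2}\Bigr)Q-\tfrac12\Bigl(\frac{(1-\mu)^2}{\rho_1^2}+\frac{\mu^2}{\rho_2^2}\Bigr)\\&+\mu(1-\mu)\Bigl[\bigl(4\dot\eta+\tfrac72\xi\bigr)\Bigl(\frac1{\rho_1}-\frac1{\rho_2}\Bigr)-\tfrac12\eta^2\Bigl(\frac{\mu}{\rho_1^3}+\frac{1-\mu}{\rho_2^3}\Bigr)+\frac{3\mu-2}{2\rho_1}-\frac1{\rho_1\rho_2}+\frac{1-3\mu}{2\rho_2}\Bigr],\end{aligned}$$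 and $w=w_0+c^{-2}w_1$, the potential of the post-Newtonian circular restricted three-body problem in rotating coordinates. Let $f=\partial w/\partial\xi$ and $g=\partial w/\partial\eta$, evaluated at $\dot\xi=\dot\eta=0$; the equilibria are the solutions of $f=g=0$. Let $$\begin{aligned} Z_0&=\Bigl(\tfrac{2499985012616009587660193140271}{5\cdot10^{30}},\tfrac{1082531750278361975463116188557}{1.25\cdot10^{30}}\Bigr),\\ P_1&=\Bigl(\tfrac{2499985512616009587660193140271}{5\cdot10^{30}},\tfrac{4330127145451017576343432330693}{5\cdot10^{30}}\Bigr),\\ P_2&=\Bigl(\tfrac{2499984762616009587660193140271}{5\cdot10^{30}},\tfrac{4330127145451017576343432330693}{5\cdot10^{30}}\Bigr),\\ P_3&=\Bigl(\tfrac{2499985512616009587660193140271}{5\cdot10^{30}},\tfrac{2165063356219154276435264800649}{2.5\cdot10^{30}}\Bigr),\\ P_4&=\Bigl(\tfrac{2499984762616009587660193140271}{5\cdot10^{30}},\tfrac{2165063356219154276435264800649}{2.5\cdot10^{30}}\Bigr), \end{aligned}$$ and, for $t\in[0,1]$, $\beta_1(t)=tP_1+(1-t)P_2$, $\beta_2(t)=tP_3+(1-t)P_4$,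 $\beta_3(t)=tP_1+(1-t)P_3$, $\beta_4(t)=tP_2+(1-t)P_4$. Then: 1. The leading decimal digits of $f$ and $g$ at these points are (the dots mean that the expansion is truncated) $$\begin{aligned} f(P_1)&=1.124997\ldots\times10^{-7},& g(P_1)&=1.94854\ldots\times10^{-7},\\ f(P_2)&=-2.22772\ldots\times10^{-13},& g(P_2)&=3.94516\ldots\times10^{-13},\\ f(P_3)&=4.60545\ldots\times10^{-13},& g(P_3)&=-7.63052\ldots\times10^{-13},\\ f(P_4)&=-1.12499\ldots\times10^{-7},& g(P_4)&=-1.94855\ldots\times10^{-7},\\ f(Z_0)&=-1.14508\ldots\times10^{-32},& g(Z_0)&=-4.25190\ldots\times10^{-32}. \end{aligned}$$ 2. $g>0$ on $\beta_1$, $g<0$ on $\beta_2$, $f>0$ on $\beta_3$ and $f<0$ on $\beta_4$. 3. There is a point $P_0$ in the open quadrilateral bounded by $\beta_1,\beta_2,\beta_3,\beta_4$ with $f(P_0)=g(P_0)=0$, and its Euclidean distance to the Newtonian point $L_4=\bigl(\frac{1-2\mu}{2},\frac{\sqrt3}{2}\bigr)$ is less than $10^{-8}$. -/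

import Mathlib

/-! The post-Newtonian circular restricted three-body problem in synodic coordinates `(ξ, η)`, with
mass parameter `μ` and speed of light `c`. Velocities are denoted `dξ`, `dη`. -/

noncomputable section

namespace RelRTBP

/-- Distance `ρ₁` to the primary of mass `1 - μ`, located at `(-μ, 0)`. -/
def rho1 (μ ξ η : ℝ) : ℝ := Real.sqrt ((ξ + μ) ^ 2 + η ^ 2)

/-- Distance `ρ₂` to the primary of mass `μ`, located at `(1 - μ, 0)`. -/
def rho2 (μ ξ η : ℝ) : ℝ := Real.sqrt ((ξ + μ - 1) ^ 2 + η ^ 2)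

/-- Distance `ρ` to the centre of mass. -/
def rho (ξ η : ℝ) : ℝ := Real.sqrt (ξ ^ 2 + η ^ 2)

/-- The Newtonian potential `w₀`. -/
def w0 (μ ξ η : ℝ) : ℝ :=
  1 / 2 * (ξ ^ 2 + η ^ 2) + (1 - μ) / rho1 μ ξ η + μ / rho2 μ ξ η

/-- The first post-Newtonian correction `w₁`. -/
def w1 (μ ξ η dξ dη : ℝ) : ℝ :=
  -(3 / 2) * (1 - 1 / 3 * μ * (1 - μ)) * rho ξ η ^ 2
  + 1 / 8 * (dη ^ 2 + 2 * (dη * ξ - dξ * η) + dξ ^ 2 + rho ξ η ^ 2) ^ 2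
  + 3 / 2 * ((1 - μ) / rho1 μ ξ η + μ / rho2 μ ξ η)
      * (dη ^ 2 + 2 * (dη * ξ - dξ * η) + dξ ^ 2 + rho ξ η ^ 2)
  - 1 / 2 * ((1 - μ) ^ 2 / rho1 μ ξ η ^ 2 + μ ^ 2 / rho2 μ ξ η ^ 2)
  + μ * (1 - μ) *
      ((4 * dη + 7 * ξ / 2) * (1 / rho1 μ ξ η - 1 / rho2 μ ξ η)
        - 1 / 2 * η ^ 2 * (μ / rho1 μ ξ η ^ 3 + (1 - μ) / rho2 μ ξ η ^ 3)
        + ((3 * μ - 2) / (2 * rho1 μ ξ η) - 1 / (rho1 μ ξ η * rho2 μ ξ η)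
            + (1 - 3 * μ) / (2 * rho2 μ ξ η)))

/-- The relativistic potential `w = w₀ + w₁ / c²`. -/
def w (μ c ξ η dξ dη : ℝ) : ℝ := w0 μ ξ η + 1 / c ^ 2 * w1 μ ξ η dξ dη

/-- `∂w/∂ξ` at zero velocity. -/
def fGen (μ c : ℝ) (p : ℝ × ℝ) : ℝ := deriv (fun x => w μ c x p.2 0 0) p.1

/-- `∂w/∂η` at zero velocity. -/
def gGen (μ c : ℝ) (p : ℝ × ℝ) : ℝ := deriv (fun y => w μ c p.1 y 0 0) p.2

/-- The mass parameter of the Earth–Sun system. -/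
def μES : ℝ := 59729 / 19885499729

/-- The speed of light (about `10065.3`) in the units in which the Earth–Sun distance is `1` and
the period is `2π`. -/
def cES : ℝ := 149896229 * Real.sqrt (1495978707 / 3317816087784734) / 10

/-- `f = ∂w/∂ξ` at zero velocity, for the Earth–Sun system. -/
def f (p : ℝ × ℝ) : ℝ := fGen μES cES p

/-- `g = ∂w/∂η` at zero velocity, for the Earth–Sun system. -/
def g (p : ℝ × ℝ) : ℝ := gGen μES cES p

def Z0 : ℝ × ℝ :=
  (2499985012616009587660193140271 / 5000000000000000000000000000000,
   1082531750278361975463116188557 / 1250000000000000000000000000000)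

def P1 : ℝ × ℝ :=
  (2499985512616009587660193140271 / 5000000000000000000000000000000,
   4330127145451017576343432330693 / 5000000000000000000000000000000)

def P2 : ℝ × ℝ :=
  (2499984762616009587660193140271 / 5000000000000000000000000000000,
   4330127145451017576343432330693 / 5000000000000000000000000000000)

def P3 : ℝ × ℝ :=
  (2499985512616009587660193140271 / 5000000000000000000000000000000,
   2165063356219154276435264800649 / 2500000000000000000000000000000)

def P4 : ℝ × ℝ :=
  (2499984762616009587660193140271 / 5000000000000000000000000000000,
   2165063356219154276435264800649 / 2500000000000000000000000000000)

def β1 (t : ℝ) : ℝ × ℝ := t • P1 + (1 - t) • P2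

def β2 (t : ℝ) : ℝ × ℝ := t • P3 + (1 - t) • P4

def β3 (t : ℝ) : ℝ × ℝ := t • P1 + (1 - t) • P3

def β4 (t : ℝ) : ℝ × ℝ := t • P2 + (1 - t) • P4

/-- The open region bounded by the four sides `β1`, `β2`, `β3`, `β4`: the interior of the (convex)
quadrilateral with vertices `P1`, `P2`, `P4`, `P3`. -/
def region : Set (ℝ × ℝ) := interior (convexHull ℝ {P1, P2, P3, P4})

end RelRTBP

end

noncomputable section

namespace RelRTBP

/-! ### Critical points of functions of two variables on a rectangle -/

/-! Since `f` and `g` are the two partial derivatives of one potential, no two-dimensional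
intermediate value theorem is needed. If the gradient points outwards along all sides of a
rectangle, a minimizer over the closed rectangle cannot lie on the boundary, so it is an interior
critical point (`exists_critical_point_of_outward_gradient`).

The side signs reduce to two vertices. Near `L₄` the mixed derivative is positive (`mixedPoly_pos`):
the Newtonian part is about `3√3/4` and the relativistic part is negligible. Hence `f` increases in
`η` and `g` increases in `ξ`. The top left vertex then controls `f` on the left side and `g` on the
top side, and the bottom right vertex controls the other two sides (`OutwardRectangle`).

The numbers are certified in rational arithmetic: the gradient is a polynomial in the coordinates
and the reciprocal distances, Lipschitz in the latter, and rational approximations of these are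
checked by squaring (`f_g_mem_Ioo`). The given quadrilateral yields the side signs; a much smaller
rectangle inside it yields the equilibrium and its distance to `L₄`. -/

theorem deriv_mul_sub_nonneg_of_isMinOn {φ : ℝ → ℝ} {φ' a b x y : ℝ} (hφ : HasDerivAt φ φ' x)
    (hx : x ∈ Set.Icc a b) (hy : y ∈ Set.Icc a b) (hmin : IsMinOn φ (Set.Icc a b) x) :
    0 ≤ φ' * (y - x) := by
  have h := hmin.localize.hasFDerivWithinAt_nonneg hφ.hasFDerivAt.hasFDerivWithinAt
    (sub_mem_posTangentConeAt_of_segment_subset ((convex_Icc a b).segment_subset hx hy))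
  simpa [mul_comm] using h

/-- If the gradient `(F, G)` of `W` points outwards along the sides of a rectangle, then `W` has a
critical point in the interior of the rectangle. -/
theorem exists_critical_point_of_outward_gradient {W F G : ℝ × ℝ → ℝ} {a b c d : ℝ}
    (hab : a ≤ b) (hcd : c ≤ d)
    (hW : ContinuousOn W (Set.Icc a b ×ˢ Set.Icc c d))
    (hF : ∀ p ∈ Set.Icc a b ×ˢ Set.Icc c d, HasDerivAt (fun x => W (x, p.2)) (F p) p.1)
    (hG : ∀ p ∈ Set.Icc a b ×ˢ Set.Icc c d, HasDerivAt (fun y => W (p.1, y)) (G p) p.2)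
    (hleft : ∀ y ∈ Set.Icc c d, F (a, y) < 0) (hright : ∀ y ∈ Set.Icc c d, 0 < F (b, y))
    (hbot : ∀ x ∈ Set.Icc a b, G (x, c) < 0) (htop : ∀ x ∈ Set.Icc a b, 0 < G (x, d)) :
    ∃ p ∈ Set.Ioo a b ×ˢ Set.Ioo c d, F p = 0 ∧ G p = 0 := by
  obtain ⟨⟨x, y⟩, hp, hmin⟩ := (isCompact_Icc.prod isCompact_Icc).exists_isMinOn
    ⟨(a, c), Set.left_mem_Icc.2 hab, Set.left_mem_Icc.2 hcd⟩ hW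
  obtain ⟨hx, hy⟩ := id hp
  have hxmin : ∀ t ∈ Set.Icc a b, 0 ≤ F (x, y) * (t - x) := fun t ht =>
    deriv_mul_sub_nonneg_of_isMinOn (hF _ hp) hx ht fun s hs => hmin (Set.mk_mem_prod hs hy)
  have hymin : ∀ t ∈ Set.Icc c d, 0 ≤ G (x, y) * (t - y) := fun t ht =>
    deriv_mul_sub_nonneg_of_isMinOn (hG _ hp) hy ht fun s hs => hmin (Set.mk_mem_prod hx hs)
  simp only at hx hy
  have hax : a < x := by
    refine lt_of_le_of_ne hx.1 fun h => ?_
    subst h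
    have h1 := hxmin b (Set.right_mem_Icc.2 hab)
    have h2 := hleft y hy
    -- A degenerate rectangle is impossible: its left and right sides would coincide while requiring
    -- opposite signs.
    rcases hab.eq_or_lt with h | h
    · subst h; exact absurd h2 (hright y hy).not_gt
    · nlinarith
  have hxb : x < b := by
    refine lt_of_le_of_ne hx.2 fun h => ?_
    subst h
    nlinarith [hxmin a (Set.left_mem_Icc.2 hab), hright y hy]
  have hcy : c < y := by
    refine lt_of_le_of_ne hy.1 fun h => ?_
    subst h
    have h1 := hymin d (Set.right_mem_Icc.2 hcd)
    have h2 := hbot x hx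
    rcases hcd.eq_or_lt with h | h
    · subst h; exact absurd h2 (htop x hx).not_gt
    · nlinarith
  have hyd : y < d := by
    refine lt_of_le_of_ne hy.2 fun h => ?_
    subst h
    nlinarith [hymin c (Set.left_mem_Icc.2 hcd), htop x hx]
  refine ⟨(x, y), ⟨⟨hax, hxb⟩, hcy, hyd⟩, le_antisymm ?_ ?_, le_antisymm ?_ ?_⟩
  · nlinarith [hxmin a (Set.left_mem_Icc.2 hab)]
  · nlinarith [hxmin b (Set.right_mem_Icc.2 hab)]
  · nlinarith [hymin c (Set.left_mem_Icc.2 hcd)]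
  · nlinarith [hymin d (Set.right_mem_Icc.2 hcd)]

/-! ### The gradient and the mixed second derivative of the potential -/

/-- The potential at rest as a polynomial in `ξ = x`, `η = y`, `u = 1 / ρ₁`, `v = 1 / ρ₂` and
`k = 1 / c²`. -/
def potPoly (μ k x y u v : ℝ) : ℝ :=
  1 / 2 * (x ^ 2 + y ^ 2) + (1 - μ) * u + μ * v +
  k * (-(3 / 2) * (1 - 1 / 3 * μ * (1 - μ)) * (x ^ 2 + y ^ 2) + 1 / 8 * (x ^ 2 + y ^ 2) ^ 2
    + 3 / 2 * ((1 - μ) * u + μ * v) * (x ^ 2 + y ^ 2)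
    - 1 / 2 * ((1 - μ) ^ 2 * u ^ 2 + μ ^ 2 * v ^ 2)
    + μ * (1 - μ) * (7 / 2 * x * (u - v) - 1 / 2 * y ^ 2 * (μ * u ^ 3 + (1 - μ) * v ^ 3)
      + (3 * μ - 2) / 2 * u - u * v + (1 - 3 * μ) / 2 * v))

/-- The partial derivative of the potential with respect to `ξ`. -/
def xPoly (μ k x y u v : ℝ) : ℝ :=
  x - (1 - μ) * (x + μ) * u ^ 3 - μ * (x + μ - 1) * v ^ 3 +
  k * (-3 * (1 - 1 / 3 * μ * (1 - μ)) * x + 1 / 2 * (x ^ 2 + y ^ 2) * x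
    + 3 * ((1 - μ) * u + μ * v) * x
    - 3 / 2 * ((1 - μ) * (x + μ) * u ^ 3 + μ * (x + μ - 1) * v ^ 3) * (x ^ 2 + y ^ 2)
    + ((1 - μ) ^ 2 * (x + μ) * u ^ 4 + μ ^ 2 * (x + μ - 1) * v ^ 4)
    + μ * (1 - μ) * (7 / 2 * (u - v) - 7 / 2 * x * ((x + μ) * u ^ 3 - (x + μ - 1) * v ^ 3)
      + 3 / 2 * y ^ 2 * (μ * (x + μ) * u ^ 5 + (1 - μ) * (x + μ - 1) * v ^ 5)
      - (3 * μ - 2) / 2 * (x + μ) * u ^ 3 + (x + μ) * u ^ 3 * v + (x + μ - 1) * u * v ^ 3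
      - (1 - 3 * μ) / 2 * (x + μ - 1) * v ^ 3))

/-- The partial derivative of the potential with respect to `η`. -/
def yPoly (μ k x y u v : ℝ) : ℝ :=
  y - (1 - μ) * y * u ^ 3 - μ * y * v ^ 3 +
  k * (-3 * (1 - 1 / 3 * μ * (1 - μ)) * y + 1 / 2 * (x ^ 2 + y ^ 2) * y
    + 3 * ((1 - μ) * u + μ * v) * y
    - 3 / 2 * ((1 - μ) * y * u ^ 3 + μ * y * v ^ 3) * (x ^ 2 + y ^ 2)
    + ((1 - μ) ^ 2 * y * u ^ 4 + μ ^ 2 * y * v ^ 4)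
    + μ * (1 - μ) * (-(7 / 2) * x * y * (u ^ 3 - v ^ 3)
      - y * (μ * u ^ 3 + (1 - μ) * v ^ 3) + 3 / 2 * y ^ 3 * (μ * u ^ 5 + (1 - μ) * v ^ 5)
      - (3 * μ - 2) / 2 * y * u ^ 3 + y * u ^ 3 * v + y * u * v ^ 3
      - (1 - 3 * μ) / 2 * y * v ^ 3))

/-- The coefficient of `1 / c²` in the mixed second derivative of the potential. -/
def mixedCorrection (μ x y u v : ℝ) : ℝ :=
  x * y - 3 * ((1 - μ) * (x + μ) * y * u ^ 3 + μ * (x + μ - 1) * y * v ^ 3)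
  - 3 * x * y * ((1 - μ) * u ^ 3 + μ * v ^ 3)
  + 9 / 2 * (x ^ 2 + y ^ 2) * y * ((1 - μ) * (x + μ) * u ^ 5 + μ * (x + μ - 1) * v ^ 5)
  - 4 * y * ((1 - μ) ^ 2 * (x + μ) * u ^ 6 + μ ^ 2 * (x + μ - 1) * v ^ 6)
  + μ * (1 - μ) * (-(7 / 2) * y * (u ^ 3 - v ^ 3)
    + 21 / 2 * x * y * ((x + μ) * u ^ 5 - (x + μ - 1) * v ^ 5)
    + 3 * y * (μ * (x + μ) * u ^ 5 + (1 - μ) * (x + μ - 1) * v ^ 5)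
    - 15 / 2 * y ^ 3 * (μ * (x + μ) * u ^ 7 + (1 - μ) * (x + μ - 1) * v ^ 7)
    + 3 / 2 * (3 * μ - 2) * (x + μ) * y * u ^ 5
    - 3 * (x + μ) * y * u ^ 5 * v - (x + μ - 1) * y * u ^ 3 * v ^ 3
    - (x + μ) * y * u ^ 3 * v ^ 3 - 3 * (x + μ - 1) * y * u * v ^ 5
    + 3 / 2 * (1 - 3 * μ) * (x + μ - 1) * y * v ^ 5)

/-- The mixed second derivative of the potential. -/
def mixedPoly (μ k x y u v : ℝ) : ℝ :=
  3 * (1 - μ) * (x + μ) * y * u ^ 5 + 3 * μ * (x + μ - 1) * y * v ^ 5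
  + k * mixedCorrection μ x y u v

theorem w_rest_eq_potPoly (μ c x y : ℝ) :
    w μ c x y 0 0 = potPoly μ (1 / c ^ 2) x y (rho1 μ x y)⁻¹ (rho2 μ x y)⁻¹ := by
  have h : rho x y ^ 2 = x ^ 2 + y ^ 2 := Real.sq_sqrt (by positivity)
  simp only [w, w0, w1, potPoly, h, div_eq_mul_inv, mul_inv, inv_pow]
  ring

/-- The derivative of a reciprocal distance is a polynomial in it and the coordinates, so all
derivatives of the potential stay polynomial. Nonzero `y` keeps the point off the primaries. -/
theorem hasDerivAt_inv_dist_fst {a x y : ℝ} (hy : y ≠ 0) :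
    HasDerivAt (fun t => (Real.sqrt ((t + a) ^ 2 + y ^ 2))⁻¹)
      (-(x + a) * (Real.sqrt ((x + a) ^ 2 + y ^ 2))⁻¹ ^ 3) x := by
  have hpos : 0 < (x + a) ^ 2 + y ^ 2 := by positivity
  have hs := Real.sqrt_pos.2 hpos
  have h : HasDerivAt (fun t => (t + a) ^ 2 + y ^ 2) (2 * (x + a)) x := by
    simpa using (((hasDerivAt_id x).add_const a).pow 2).add_const (y ^ 2)
  refine (h.sqrt hpos.ne').inv hs.ne' |>.congr_deriv ?_
  field_simp

theorem hasDerivAt_inv_dist_snd {b y : ℝ} (hy : y ≠ 0) :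
    HasDerivAt (fun t => (Real.sqrt (b ^ 2 + t ^ 2))⁻¹)
      (-y * (Real.sqrt (b ^ 2 + y ^ 2))⁻¹ ^ 3) y := by
  have hpos : 0 < b ^ 2 + y ^ 2 := by positivity
  have hs := Real.sqrt_pos.2 hpos
  have h : HasDerivAt (fun t => b ^ 2 + t ^ 2) (2 * y) y := by
    simpa using ((hasDerivAt_id y).pow 2).const_add (b ^ 2)
  refine (h.sqrt hpos.ne').inv hs.ne' |>.congr_deriv ?_
  field_simp

theorem hasDerivAt_inv_rho1_fst (μ x : ℝ) {y : ℝ} (hy : y ≠ 0) :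
    HasDerivAt (fun t => (rho1 μ t y)⁻¹) (-(x + μ) * (rho1 μ x y)⁻¹ ^ 3) x :=
  hasDerivAt_inv_dist_fst hy

theorem hasDerivAt_inv_rho2_fst (μ x : ℝ) {y : ℝ} (hy : y ≠ 0) :
    HasDerivAt (fun t => (rho2 μ t y)⁻¹) (-(x + μ - 1) * (rho2 μ x y)⁻¹ ^ 3) x := by
  have h := hasDerivAt_inv_dist_fst (a := μ - 1) (x := x) hy
  simpa only [rho2, add_sub_assoc] using h

theorem hasDerivAt_inv_rho1_snd (μ x : ℝ) {y : ℝ} (hy : y ≠ 0) :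
    HasDerivAt (fun t => (rho1 μ x t)⁻¹) (-y * (rho1 μ x y)⁻¹ ^ 3) y :=
  hasDerivAt_inv_dist_snd hy

theorem hasDerivAt_inv_rho2_snd (μ x : ℝ) {y : ℝ} (hy : y ≠ 0) :
    HasDerivAt (fun t => (rho2 μ x t)⁻¹) (-y * (rho2 μ x y)⁻¹ ^ 3) y :=
  hasDerivAt_inv_dist_snd hy

/-- One chain rule along an arbitrary curve, from which both partial derivatives are obtained. -/
theorem hasDerivAt_potPoly {μ k t : ℝ} {x y u v : ℝ → ℝ} {x' y' u' v' : ℝ}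
    (hx : HasDerivAt x x' t) (hy : HasDerivAt y y' t)
    (hu : HasDerivAt u u' t) (hv : HasDerivAt v v' t) :
    HasDerivAt (fun s => potPoly μ k (x s) (y s) (u s) (v s))
      (x t * x' + y t * y' + (1 - μ) * u' + μ * v' +
        k * (-(3 / 2) * (1 - 1 / 3 * μ * (1 - μ)) * (2 * x t * x' + 2 * y t * y')
          + 1 / 2 * (x t ^ 2 + y t ^ 2) * (x t * x' + y t * y')
          + 3 / 2 * (((1 - μ) * u' + μ * v') * (x t ^ 2 + y t ^ 2)
            + ((1 - μ) * u t + μ * v t) * (2 * x t * x' + 2 * y t * y'))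
          - ((1 - μ) ^ 2 * u t * u' + μ ^ 2 * v t * v')
          + μ * (1 - μ) * (7 / 2 * (x' * (u t - v t) + x t * (u' - v'))
            - y t * y' * (μ * u t ^ 3 + (1 - μ) * v t ^ 3)
            - 3 / 2 * y t ^ 2 * (μ * u t ^ 2 * u' + (1 - μ) * v t ^ 2 * v')
            + (3 * μ - 2) / 2 * u' - (u' * v t + u t * v') + (1 - 3 * μ) / 2 * v'))) t := by
  have hR := (hx.pow 2).add (hy.pow 2)
  have hM := (hu.const_mul (1 - μ)).add (hv.const_mul μ)
  have h0 := ((hR.const_mul (1 / 2)).add (hu.const_mul (1 - μ))).add (hv.const_mul μ)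
  have h1 := ((hR.const_mul (-(3 / 2) * (1 - 1 / 3 * μ * (1 - μ)))).add
    ((hR.pow 2).const_mul (1 / 8))).add ((hM.const_mul (3 / 2)).mul hR)
  have h2 := (((hu.pow 2).const_mul ((1 - μ) ^ 2)).add
    ((hv.pow 2).const_mul (μ ^ 2))).const_mul (1 / 2)
  have h3 := ((hx.const_mul (7 / 2)).mul (hu.sub hv)).sub
    (((hy.pow 2).const_mul (1 / 2)).mul
      (((hu.pow 3).const_mul μ).add ((hv.pow 3).const_mul (1 - μ))))
  have h4 := ((h3.add (hu.const_mul ((3 * μ - 2) / 2))).sub (hu.mul hv)).add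
    (hv.const_mul ((1 - 3 * μ) / 2))
  refine (h0.add (((h1.sub h2).add (h4.const_mul (μ * (1 - μ)))).const_mul k)).congr_deriv ?_
  simp only [Pi.add_apply, Pi.pow_apply, Pi.sub_apply, Nat.cast_ofNat]
  ring

theorem hasDerivAt_w_fst (μ c x : ℝ) {y : ℝ} (hy : y ≠ 0) :
    HasDerivAt (fun t => w μ c t y 0 0)
      (xPoly μ (1 / c ^ 2) x y (rho1 μ x y)⁻¹ (rho2 μ x y)⁻¹) x := by
  simp only [w_rest_eq_potPoly]
  refine (hasDerivAt_potPoly (hasDerivAt_id x) (hasDerivAt_const x y)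
    (hasDerivAt_inv_rho1_fst μ x hy) (hasDerivAt_inv_rho2_fst μ x hy)).congr_deriv ?_
  simp only [xPoly, id]
  ring

theorem hasDerivAt_w_snd (μ c x : ℝ) {y : ℝ} (hy : y ≠ 0) :
    HasDerivAt (fun t => w μ c x t 0 0)
      (yPoly μ (1 / c ^ 2) x y (rho1 μ x y)⁻¹ (rho2 μ x y)⁻¹) y := by
  simp only [w_rest_eq_potPoly]
  refine (hasDerivAt_potPoly (hasDerivAt_const y x) (hasDerivAt_id y)
    (hasDerivAt_inv_rho1_snd μ x hy) (hasDerivAt_inv_rho2_snd μ x hy)).congr_deriv ?_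
  simp only [yPoly, id]
  ring

theorem fGen_eq_xPoly (μ c x : ℝ) {y : ℝ} (hy : y ≠ 0) :
    fGen μ c (x, y) = xPoly μ (1 / c ^ 2) x y (rho1 μ x y)⁻¹ (rho2 μ x y)⁻¹ :=
  (hasDerivAt_w_fst μ c x hy).deriv

theorem gGen_eq_yPoly (μ c x : ℝ) {y : ℝ} (hy : y ≠ 0) :
    gGen μ c (x, y) = yPoly μ (1 / c ^ 2) x y (rho1 μ x y)⁻¹ (rho2 μ x y)⁻¹ :=
  (hasDerivAt_w_snd μ c x hy).deriv

theorem hasDerivAt_xPoly_snd (μ k x : ℝ) {y : ℝ} (hy : y ≠ 0) :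
    HasDerivAt (fun t => xPoly μ k x t (rho1 μ x t)⁻¹ (rho2 μ x t)⁻¹)
      (mixedPoly μ k x y (rho1 μ x y)⁻¹ (rho2 μ x y)⁻¹) y := by
  have hu := hasDerivAt_inv_rho1_snd μ x hy
  have hv := hasDerivAt_inv_rho2_snd μ x hy
  have hy2 := (hasDerivAt_id y).pow 2
  have hR := hy2.const_add (x ^ 2)
  have h0 := ((hasDerivAt_const y x).sub ((hu.pow 3).const_mul ((1 - μ) * (x + μ)))).sub
    ((hv.pow 3).const_mul (μ * (x + μ - 1)))
  have hN := ((hu.pow 3).const_mul ((1 - μ) * (x + μ))).add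
    ((hv.pow 3).const_mul (μ * (x + μ - 1)))
  have h1 := ((((hasDerivAt_const y (-3 * (1 - 1 / 3 * μ * (1 - μ)) * x)).add
    ((hR.const_mul (1 / 2)).mul_const x)).add
    ((((hu.const_mul (1 - μ)).add (hv.const_mul μ)).const_mul 3).mul_const x)).sub
    ((hN.const_mul (3 / 2)).mul hR)).add
    (((hu.pow 4).const_mul ((1 - μ) ^ 2 * (x + μ))).add
      ((hv.pow 4).const_mul (μ ^ 2 * (x + μ - 1))))
  have h2 := ((((((hu.sub hv).const_mul (7 / 2)).sub
    ((((hu.pow 3).const_mul (x + μ)).sub ((hv.pow 3).const_mul (x + μ - 1))).const_mul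
      (7 / 2 * x))).add
    ((hy2.const_mul (3 / 2)).mul (((hu.pow 5).const_mul (μ * (x + μ))).add
      ((hv.pow 5).const_mul ((1 - μ) * (x + μ - 1)))))).sub
    ((hu.pow 3).const_mul ((3 * μ - 2) / 2 * (x + μ)))).add
    (((hu.pow 3).const_mul (x + μ)).mul hv)).add
    ((hu.const_mul (x + μ - 1)).mul (hv.pow 3))
  have h3 := h2.sub ((hv.pow 3).const_mul ((1 - 3 * μ) / 2 * (x + μ - 1)))
  refine (h0.add ((h1.add (h3.const_mul (μ * (1 - μ)))).const_mul k)).congr_deriv ?_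
  simp only [mixedPoly, mixedCorrection, Pi.add_apply, Pi.pow_apply,
    Nat.cast_ofNat, id]
  ring

theorem hasDerivAt_yPoly_fst (μ k x : ℝ) {y : ℝ} (hy : y ≠ 0) :
    HasDerivAt (fun t => yPoly μ k t y (rho1 μ t y)⁻¹ (rho2 μ t y)⁻¹)
      (mixedPoly μ k x y (rho1 μ x y)⁻¹ (rho2 μ x y)⁻¹) x := by
  have hu := hasDerivAt_inv_rho1_fst μ x hy
  have hv := hasDerivAt_inv_rho2_fst μ x hy
  have hR := ((hasDerivAt_id x).pow 2).add_const (y ^ 2)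
  have h0 := ((hasDerivAt_const x y).sub ((hu.pow 3).const_mul ((1 - μ) * y))).sub
    ((hv.pow 3).const_mul (μ * y))
  have h1 := ((((hasDerivAt_const x (-3 * (1 - 1 / 3 * μ * (1 - μ)) * y)).add
    ((hR.const_mul (1 / 2)).mul_const y)).add
    ((((hu.const_mul (1 - μ)).add (hv.const_mul μ)).const_mul 3).mul_const y)).sub
    (((((hu.pow 3).const_mul ((1 - μ) * y)).add
      ((hv.pow 3).const_mul (μ * y))).const_mul (3 / 2)).mul hR)).add
    (((hu.pow 4).const_mul ((1 - μ) ^ 2 * y)).add ((hv.pow 4).const_mul (μ ^ 2 * y)))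
  have h2 := (((((((hasDerivAt_id x).const_mul (-(7 / 2))).mul_const y).mul
    ((hu.pow 3).sub (hv.pow 3))).sub
    ((((hu.pow 3).const_mul μ).add ((hv.pow 3).const_mul (1 - μ))).const_mul y)).add
    ((((hu.pow 5).const_mul μ).add ((hv.pow 5).const_mul (1 - μ))).const_mul
      (3 / 2 * y ^ 3))).sub
    ((hu.pow 3).const_mul ((3 * μ - 2) / 2 * y))).add
    (((hu.pow 3).const_mul y).mul hv)
  have h3 := (h2.add ((hu.const_mul y).mul (hv.pow 3))).sub
    ((hv.pow 3).const_mul ((1 - 3 * μ) / 2 * y))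
  refine (h0.add ((h1.add (h3.const_mul (μ * (1 - μ)))).const_mul k)).congr_deriv ?_
  simp only [mixedPoly, mixedCorrection, Pi.add_apply, Pi.pow_apply, Pi.sub_apply,
    Nat.cast_ofNat, id]
  ring

/-! ### Bounds for the gradient and the mixed second derivative -/

theorem abs_add_le_of_le {a b A B : ℝ} (ha : |a| ≤ A) (hb : |b| ≤ B) : |a + b| ≤ A + B :=
  (abs_add_le a b).trans (add_le_add ha hb)

theorem abs_sub_le_of_le {a b A B : ℝ} (ha : |a| ≤ A) (hb : |b| ≤ B) : |a - b| ≤ A + B :=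
  (abs_sub a b).trans (add_le_add ha hb)

theorem abs_mul_le_of_le {a b A B : ℝ} (ha : |a| ≤ A) (hb : |b| ≤ B) : |a * b| ≤ A * B := by
  rw [abs_mul]
  exact mul_le_mul ha hb (abs_nonneg b) ((abs_nonneg a).trans ha)

theorem abs_pow_le_of_le {a A : ℝ} {n : ℕ} (ha : |a| ≤ A) : |a ^ n| ≤ A ^ n := by
  rw [abs_pow]
  exact pow_le_pow_left₀ (abs_nonneg a) ha n

/-- A deliberately crude bound: the coefficient `kES` is below `10⁻⁷`, so even `10⁶` costs only
`1/10`. -/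
theorem abs_mixedCorrection_le {μ x y u v : ℝ} (hμ : |μ| ≤ 1) (hx : |x| ≤ 1) (hy : |y| ≤ 1)
    (hu : |u| ≤ 2) (hv : |v| ≤ 2) : |mixedCorrection μ x y u v| ≤ 10 ^ 6 := by
  have hm : |1 - μ| ≤ 2 := by grind
  have hX : |x + μ| ≤ 2 := by grind
  have hY : |x + μ - 1| ≤ 3 := by grind
  unfold mixedCorrection
  -- The intermediate bound is a metavariable, filled in by the triangle inequality along the
  -- expression tree; `assumption` comes first so that the bounds on `1 - μ`, `x + μ` and `x + μ -
  -- 1` are used whole.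
  apply le_trans
  · repeat' first
      | assumption
      | apply abs_sub_le_of_le
      | apply abs_add_le_of_le
      | apply abs_mul_le_of_le
      | apply abs_pow_le_of_le
      | exact le_rfl
  · norm_num

/-- The value of `1 / c²` for the Earth–Sun system. -/
def kES : ℝ := 331781608778473400 / (149896229 ^ 2 * 1495978707)

theorem one_div_cES_sq : 1 / cES ^ 2 = kES := by
  rw [cES, kES, div_pow, mul_pow, Real.sq_sqrt (by norm_num)]
  norm_num

theorem f_eq_xPoly (x : ℝ) {y : ℝ} (hy : y ≠ 0) :
    f (x, y) = xPoly μES kES x y (rho1 μES x y)⁻¹ (rho2 μES x y)⁻¹ := by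
  rw [f, fGen_eq_xPoly _ _ _ hy, one_div_cES_sq]

theorem g_eq_yPoly (x : ℝ) {y : ℝ} (hy : y ≠ 0) :
    g (x, y) = yPoly μES kES x y (rho1 μES x y)⁻¹ (rho2 μES x y)⁻¹ := by
  rw [g, gGen_eq_yPoly _ _ _ hy, one_div_cES_sq]

theorem abs_inv_sqrt_sub_le {s a e : ℝ} (hs : 0 < s) (ha : 0 ≤ a + e)
    (hl : (a - e) ^ 2 * s ≤ 1) (hr : 1 ≤ (a + e) ^ 2 * s) : |(Real.sqrt s)⁻¹ - a| ≤ e := by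
  rw [← Real.sqrt_inv, abs_le]
  constructor
  · have : a - e ≤ Real.sqrt s⁻¹ :=
      Real.le_sqrt_of_sq_le (by rwa [inv_eq_one_div, le_div_iff₀ hs])
    linarith
  · have : Real.sqrt s⁻¹ ≤ a + e :=
      Real.sqrt_le_iff.2 ⟨ha, by rwa [inv_eq_one_div, div_le_iff₀ hs]⟩
    linarith

theorem mixedPoly_pos {x y : ℝ} (hx : x ∈ Set.Icc (0.4999 : ℝ) 0.5001)
    (hy : y ∈ Set.Icc (0.866 : ℝ) 0.8661) :
    0 < mixedPoly μES kES x y (rho1 μES x y)⁻¹ (rho2 μES x y)⁻¹ := by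
  obtain ⟨hx1, hx2⟩ := hx
  obtain ⟨hy1, hy2⟩ := hy
  have hμ : 0 < μES ∧ μES < 1 / 100000 := by norm_num [μES]
  have hk : 0 < kES ∧ kES < 1 / 10 ^ 7 := by norm_num [kES]
  have hu : |(rho1 μES x y)⁻¹ - 1| ≤ 1 / 100 := by
    apply abs_inv_sqrt_sub_le <;> nlinarith
  have hv : |(rho2 μES x y)⁻¹ - 1| ≤ 1 / 100 := by
    apply abs_inv_sqrt_sub_le <;> nlinarith
  generalize (rho1 μES x y)⁻¹ = u at *
  generalize (rho2 μES x y)⁻¹ = v at *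
  rw [abs_le] at hu hv
  have hc := abs_le.1 (abs_mixedCorrection_le (μ := μES) (x := x) (y := y) (u := u) (v := v)
    (abs_le.2 ⟨by linarith, by linarith⟩) (abs_le.2 ⟨by linarith, by linarith⟩)
    (abs_le.2 ⟨by linarith, by linarith⟩) (abs_le.2 ⟨by linarith, by linarith⟩)
    (abs_le.2 ⟨by linarith, by linarith⟩))
  have hy0 : 0 ≤ y := by linarith
  have hX0 : 0 ≤ x + μES := by linarith
  have hm0 : 0 ≤ 1 - μES := by linarith
  have hv0 : 0 ≤ v := by linarith
  -- The dominant term exceeds `1.2`, whereas the two remaining ones together are at least about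
  -- `-0.1`.
  have h1 : (3 : ℝ) * (1 - 1 / 100000) * 0.4999 * 0.866 * 0.99 ^ 5 ≤
      3 * (1 - μES) * (x + μES) * y * u ^ 5 := by
    gcongr <;> first | positivity | linarith
  have h2 : 3 * μES * (1 - x - μES) * y * v ^ 5 ≤ 3 * (1 / 100000) * 1 * 1 * (1.01 : ℝ) ^ 5 := by
    gcongr <;> first | positivity | linarith
  have h3 : -(1 / 10) ≤ kES * mixedCorrection μES x y u v := by nlinarith
  have h4 : 3 * μES * (x + μES - 1) * y * v ^ 5 = -(3 * μES * (1 - x - μES) * y * v ^ 5) := by ring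
  rw [mixedPoly, h4]
  norm_num at h1 h2
  linarith

theorem strictMonoOn_f_snd {x : ℝ} (hx : x ∈ Set.Icc (0.4999 : ℝ) 0.5001) :
    StrictMonoOn (fun y => f (x, y)) (Set.Icc (0.866 : ℝ) 0.8661) := by
  have h0 : ∀ y ∈ Set.Icc (0.866 : ℝ) 0.8661, y ≠ 0 := fun y hy => by
    have := hy.1
    norm_num at this
    linarith
  have hd := fun y hy => hasDerivAt_xPoly_snd μES kES x (h0 y hy)
  have hmono := strictMonoOn_of_deriv_pos (convex_Icc (0.866 : ℝ) 0.8661)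
    (fun y hy => (hd y hy).continuousAt.continuousWithinAt) fun y hy => by
      rw [(hd y (interior_subset hy)).deriv]
      exact mixedPoly_pos hx (interior_subset hy)
  exact hmono.congr fun y hy => (f_eq_xPoly x (h0 y hy)).symm

theorem strictMonoOn_g_fst {y : ℝ} (hy : y ∈ Set.Icc (0.866 : ℝ) 0.8661) :
    StrictMonoOn (fun x => g (x, y)) (Set.Icc (0.4999 : ℝ) 0.5001) := by
  have h0 : y ≠ 0 := by
    have := hy.1
    norm_num at this
    linarith
  have hd := fun x => hasDerivAt_yPoly_fst μES kES x h0
  have hmono := strictMonoOn_of_deriv_pos (convex_Icc (0.4999 : ℝ) 0.5001)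
    (fun x _ => (hd x).continuousAt.continuousWithinAt) fun x hx => by
      rw [(hd x).deriv]
      exact mixedPoly_pos (interior_subset hx) hy
  exact hmono.congr fun x _ => (g_eq_yPoly x h0).symm

/-! ### Lipschitz dependence of the gradient on the reciprocal distances. -/

theorem abs_pow_sub_pow_le {u a e : ℝ} (hu : |u| ≤ 2) (ha : |a| ≤ 2) (he : |u - a| ≤ e) (n : ℕ) :
    |u ^ (n + 1) - a ^ (n + 1)| ≤ (n + 1) * 2 ^ n * e := by
  have he0 : 0 ≤ e := (abs_nonneg _).trans he
  induction n with
  | zero => simpa using he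
  | succ n ih =>
    have h : u ^ (n + 1 + 1) - a ^ (n + 1 + 1)
        = u * (u ^ (n + 1) - a ^ (n + 1)) + (u - a) * a ^ (n + 1) := by ring
    rw [h]
    refine (abs_add_le_of_le (abs_mul_le_of_le hu ih)
      (abs_mul_le_of_le he (abs_pow_le_of_le ha))).trans (le_of_eq ?_)
    push_cast
    ring

theorem abs_mul_sub_mul_le {u v a b A B d e : ℝ} (ha : |a| ≤ A) (hv : |v| ≤ B)
    (hd : |u - a| ≤ d) (he : |v - b| ≤ e) : |u * v - a * b| ≤ d * B + A * e := by
  have h : u * v - a * b = (u - a) * v + a * (v - b) := by ring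
  rw [h]
  exact abs_add_le_of_le (abs_mul_le_of_le hd hv) (abs_mul_le_of_le ha he)

section Lipschitz

variable {μ k x y u v a b e : ℝ}

/-- The constant is dominated by `(1 - μ)(x + μ)(u³ - a³)`, bounded by `2 · 2 · 12 e`; every other
term carries a small factor `μ` or `k`. -/
theorem abs_xPoly_sub_le (hμ : |μ| ≤ 1 / 1000) (hk : |k| ≤ 1 / 1000) (hx : |x| ≤ 1)
    (hy : |y| ≤ 1) (hu : |u| ≤ 2) (hv : |v| ≤ 2) (ha : |a| ≤ 2) (hb : |b| ≤ 2)
    (hua : |u - a| ≤ e) (hvb : |v - b| ≤ e) :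
    |xPoly μ k x y u v - xPoly μ k x y a b| ≤ 100 * e := by
  have he : 0 ≤ e := (abs_nonneg _).trans hua
  have hm : |1 - μ| ≤ 2 := by grind
  have hX : |x + μ| ≤ 2 := by grind
  have hY : |x + μ - 1| ≤ 3 := by grind
  have hu3 := abs_pow_sub_pow_le hu ha hua 2
  have hu4 := abs_pow_sub_pow_le hu ha hua 3
  have hu5 := abs_pow_sub_pow_le hu ha hua 4
  have hv3 := abs_pow_sub_pow_le hv hb hvb 2
  have hv4 := abs_pow_sub_pow_le hv hb hvb 3
  have hv5 := abs_pow_sub_pow_le hv hb hvb 4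
  have hu3v := abs_mul_sub_mul_le (abs_pow_le_of_le (n := 3) ha) hv hu3 hvb
  have huv3 := abs_mul_sub_mul_le ha (abs_pow_le_of_le (n := 3) hv) hua hv3
  norm_num at hu3 hu4 hu5 hv3 hv4 hv5 hu3v huv3
  -- Each summand is regrouped to contain a difference already estimated. The factors `(3μ - 2)/2`
  -- and `(1 - 3μ)/2` are expanded because the bounding lemmas do not treat quotients.
  have key : xPoly μ k x y u v - xPoly μ k x y a b =
      k * (3 * ((1 - μ) * (u - a) + μ * (v - b)) * x
        - 3 / 2 * ((1 - μ) * (x + μ) * (u ^ 3 - a ^ 3) + μ * (x + μ - 1) * (v ^ 3 - b ^ 3))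
          * (x ^ 2 + y ^ 2)
        + ((1 - μ) ^ 2 * (x + μ) * (u ^ 4 - a ^ 4) + μ ^ 2 * (x + μ - 1) * (v ^ 4 - b ^ 4))
        + μ * (1 - μ) * (7 / 2 * ((u - a) - (v - b))
          - 7 / 2 * x * ((x + μ) * (u ^ 3 - a ^ 3) - (x + μ - 1) * (v ^ 3 - b ^ 3))
          + 3 / 2 * y ^ 2 * (μ * (x + μ) * (u ^ 5 - a ^ 5)
            + (1 - μ) * (x + μ - 1) * (v ^ 5 - b ^ 5))
          - (3 / 2 * μ - 1) * (x + μ) * (u ^ 3 - a ^ 3) + (x + μ) * (u ^ 3 * v - a ^ 3 * b)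
          + (x + μ - 1) * (u * v ^ 3 - a * b ^ 3)
          - (1 / 2 - 3 / 2 * μ) * (x + μ - 1) * (v ^ 3 - b ^ 3)))
      - (1 - μ) * (x + μ) * (u ^ 3 - a ^ 3) - μ * (x + μ - 1) * (v ^ 3 - b ^ 3) := by
    simp only [xPoly]
    ring
  rw [key]
  apply le_trans
  · repeat' first
      | assumption
      | apply abs_sub_le_of_le
      | apply abs_add_le_of_le
      | apply abs_mul_le_of_le
      | apply abs_pow_le_of_le
      | exact le_rfl
  · norm_num [abs_of_pos]
    ring_nf
    linarith

theorem abs_yPoly_sub_le (hμ : |μ| ≤ 1 / 1000) (hk : |k| ≤ 1 / 1000) (hx : |x| ≤ 1)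
    (hy : |y| ≤ 1) (hu : |u| ≤ 2) (hv : |v| ≤ 2) (ha : |a| ≤ 2) (hb : |b| ≤ 2)
    (hua : |u - a| ≤ e) (hvb : |v - b| ≤ e) :
    |yPoly μ k x y u v - yPoly μ k x y a b| ≤ 100 * e := by
  have he : 0 ≤ e := (abs_nonneg _).trans hua
  have hm : |1 - μ| ≤ 2 := by grind
  have hu3 := abs_pow_sub_pow_le hu ha hua 2
  have hu4 := abs_pow_sub_pow_le hu ha hua 3
  have hu5 := abs_pow_sub_pow_le hu ha hua 4
  have hv3 := abs_pow_sub_pow_le hv hb hvb 2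
  have hv4 := abs_pow_sub_pow_le hv hb hvb 3
  have hv5 := abs_pow_sub_pow_le hv hb hvb 4
  have hu3v := abs_mul_sub_mul_le (abs_pow_le_of_le (n := 3) ha) hv hu3 hvb
  have huv3 := abs_mul_sub_mul_le ha (abs_pow_le_of_le (n := 3) hv) hua hv3
  norm_num at hu3 hu4 hu5 hv3 hv4 hv5 hu3v huv3
  have key : yPoly μ k x y u v - yPoly μ k x y a b =
      k * (3 * ((1 - μ) * (u - a) + μ * (v - b)) * y
        - 3 / 2 * ((1 - μ) * y * (u ^ 3 - a ^ 3) + μ * y * (v ^ 3 - b ^ 3)) * (x ^ 2 + y ^ 2)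
        + ((1 - μ) ^ 2 * y * (u ^ 4 - a ^ 4) + μ ^ 2 * y * (v ^ 4 - b ^ 4))
        + μ * (1 - μ) * (7 / 2 * x * y * ((v ^ 3 - b ^ 3) - (u ^ 3 - a ^ 3))
          - y * (μ * (u ^ 3 - a ^ 3) + (1 - μ) * (v ^ 3 - b ^ 3))
          + 3 / 2 * y ^ 3 * (μ * (u ^ 5 - a ^ 5) + (1 - μ) * (v ^ 5 - b ^ 5))
          - (3 / 2 * μ - 1) * y * (u ^ 3 - a ^ 3) + y * (u ^ 3 * v - a ^ 3 * b)
          + y * (u * v ^ 3 - a * b ^ 3) - (1 / 2 - 3 / 2 * μ) * y * (v ^ 3 - b ^ 3)))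
      - (1 - μ) * y * (u ^ 3 - a ^ 3) - μ * y * (v ^ 3 - b ^ 3) := by
    simp only [yPoly]
    ring
  rw [key]
  apply le_trans
  · repeat' first
      | assumption
      | apply abs_sub_le_of_le
      | apply abs_add_le_of_le
      | apply abs_mul_le_of_le
      | apply abs_pow_le_of_le
      | exact le_rfl
  · norm_num [abs_of_pos]
    ring_nf
    linarith

end Lipschitz

/-! ### Enclosures of the gradient at given points -/

/-- Approximations `a`, `b` of `1 / ρ₁` and `1 / ρ₂` up to `e` give the gradient up to `100 e`. -/
theorem f_g_mem_Ioo {x y a b e F₁ F₂ G₁ G₂ : ℝ} (hx : |x| ≤ 1) (hy : 0 < y ∧ y ≤ 1)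
    (he : 0 ≤ e ∧ e ≤ 1 / 2) (ha : 0 ≤ a ∧ a ≤ 3 / 2) (hb : 0 ≤ b ∧ b ≤ 3 / 2)
    (hu : (a - e) ^ 2 * ((x + μES) ^ 2 + y ^ 2) ≤ 1 ∧ 1 ≤ (a + e) ^ 2 * ((x + μES) ^ 2 + y ^ 2))
    (hv : (b - e) ^ 2 * ((x + μES - 1) ^ 2 + y ^ 2) ≤ 1 ∧
      1 ≤ (b + e) ^ 2 * ((x + μES - 1) ^ 2 + y ^ 2))
    (hF : F₁ + 100 * e < xPoly μES kES x y a b ∧ xPoly μES kES x y a b < F₂ - 100 * e)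
    (hG : G₁ + 100 * e < yPoly μES kES x y a b ∧ yPoly μES kES x y a b < G₂ - 100 * e) :
    f (x, y) ∈ Set.Ioo F₁ F₂ ∧ g (x, y) ∈ Set.Ioo G₁ G₂ := by
  obtain ⟨hy0, hy1⟩ := hy
  have hua : |(rho1 μES x y)⁻¹ - a| ≤ e :=
    abs_inv_sqrt_sub_le (by positivity) (by linarith) hu.1 hu.2
  have hvb : |(rho2 μES x y)⁻¹ - b| ≤ e :=
    abs_inv_sqrt_sub_le (by positivity) (by linarith) hv.1 hv.2
  rw [f_eq_xPoly x hy0.ne', g_eq_yPoly x hy0.ne']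
  generalize (rho1 μES x y)⁻¹ = u at *
  generalize (rho2 μES x y)⁻¹ = v at *
  have hu' := abs_le.1 hua
  have hv' := abs_le.1 hvb
  have hμ : |μES| ≤ 1 / 1000 := by norm_num [μES, abs_le]
  have hk : |kES| ≤ 1 / 1000 := by norm_num [kES, abs_le]
  have hy' : |y| ≤ 1 := abs_le.2 ⟨by linarith, hy1⟩
  have hu2 : |u| ≤ 2 := abs_le.2 ⟨by linarith, by linarith⟩
  have hv2 : |v| ≤ 2 := abs_le.2 ⟨by linarith, by linarith⟩
  have ha2 : |a| ≤ 2 := abs_le.2 ⟨by linarith, by linarith⟩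
  have hb2 : |b| ≤ 2 := abs_le.2 ⟨by linarith, by linarith⟩
  have hf := abs_le.1 (abs_xPoly_sub_le hμ hk hx hy' hu2 hv2 ha2 hb2 hua hvb)
  have hg := abs_le.1 (abs_yPoly_sub_le hμ hk hx hy' hu2 hv2 ha2 hb2 hua hvb)
  exact ⟨⟨by linarith, by linarith⟩, ⟨by linarith, by linarith⟩⟩

/-- The numbers `a`, `b` are decimal approximations of the reciprocal distances, with `100 e` well
below the last digit claimed; all conditions are rational inequalities. -/
theorem f_g_P1 : f P1 ∈ Set.Ioo (1.124997 / 10 ^ 7 : ℝ) (1.124998 / 10 ^ 7) ∧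
    g P1 ∈ Set.Ioo (1.94854 / 10 ^ 7 : ℝ) (1.94855 / 10 ^ 7) := by
  apply f_g_mem_Ioo (a := 999999925000009507029379 / 10 ^ 24)
    (b := 1000000031169117998835179 / 10 ^ 24) (e := 1 / 10 ^ 24) <;>
    norm_num [xPoly, yPoly, μES, kES, abs_le]

theorem f_g_P2 : f P2 ∈ Set.Ioo (-2.22773 / 10 ^ 13 : ℝ) (-2.22772 / 10 ^ 13) ∧
    g P2 ∈ Set.Ioo (3.94516 / 10 ^ 13 : ℝ) (3.94517 / 10 ^ 13) := by
  apply f_g_mem_Ioo (a := 1000000000000005744897996 / 10 ^ 24)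
    (b := 999999956169124098650377 / 10 ^ 24) (e := 1 / 10 ^ 24) <;>
    norm_num [xPoly, yPoly, μES, kES, abs_le]

theorem f_g_P3 : f P3 ∈ Set.Ioo (4.60545 / 10 ^ 13 : ℝ) (4.60546 / 10 ^ 13) ∧
    g P3 ∈ Set.Ioo (-7.63053 / 10 ^ 13 : ℝ) (-7.63052 / 10 ^ 13) := by
  apply f_g_mem_Ioo (a := 1000000000000000746243463 / 10 ^ 24)
    (b := 1000000106169133126102002 / 10 ^ 24) (e := 1 / 10 ^ 24) <;>
    norm_num [xPoly, yPoly, μES, kES, abs_le]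

theorem f_g_P4 : f P4 ∈ Set.Ioo (-1.12500 / 10 ^ 7 : ℝ) (-1.12499 / 10 ^ 7) ∧
    g P4 ∈ Set.Ioo (-1.94856 / 10 ^ 7 : ℝ) (-1.94855 / 10 ^ 7) := by
  apply f_g_mem_Ioo (a := 1000000075000013859113059 / 10 ^ 24)
    (b := 1000000031169122350915695 / 10 ^ 24) (e := 1 / 10 ^ 24) <;>
    norm_num [xPoly, yPoly, μES, kES, abs_le]

theorem f_g_Z0 : f Z0 ∈ Set.Ioo (-1.14509 / 10 ^ 32 : ℝ) (-1.14508 / 10 ^ 32) ∧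
    g Z0 ∈ Set.Ioo (-4.25191 / 10 ^ 32 : ℝ) (-4.25190 / 10 ^ 32) := by
  -- Values of size `10⁻³²` to six digits require far more precision than at the vertices.
  apply f_g_mem_Ioo (a := 10000000000000074120131788952274137983115790044 / 10 ^ 46)
    (b := 10000000061691229411339844611259914943790428090 / 10 ^ 46) (e := 1 / 10 ^ 46) <;>
    norm_num [xPoly, yPoly, μES, kES, abs_le]

/-- Only the signs matter here; the endpoints `±1` are placeholders. -/
theorem f_g_topLeft : f (0.4999970015232019, 0.86602540080003958) ∈ Set.Ioo (-1 : ℝ) (0) ∧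
    g (0.4999970015232019, 0.86602540080003958) ∈ Set.Ioo (0 : ℝ) (1) := by
  apply f_g_mem_Ioo (a := 1000000000000007661783934 / 10 ^ 24)
    (b := 1000000005169123156365335 / 10 ^ 24) (e := 1 / 10 ^ 24) <;>
    norm_num [xPoly, yPoly, μES, kES, abs_le]

theorem f_g_bottomRight : f (0.4999970035232019, 0.86602539964533958) ∈ Set.Ioo (0 : ℝ) (1) ∧
    g (0.4999970035232019, 0.86602539964533958) ∈ Set.Ioo (-1 : ℝ) (0) := by
  apply f_g_mem_Ioo (a := 1000000000000007179082842 / 10 ^ 24)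
    (b := 1000000007169122710678973 / 10 ^ 24) (e := 1 / 10 ^ 24) <;>
    norm_num [xPoly, yPoly, μES, kES, abs_le]

/-! ### Signs on the sides of a rectangle, and the equilibrium -/

theorem continuousOn_w (μ c : ℝ) :
    ContinuousOn (fun p : ℝ × ℝ => w μ c p.1 p.2 0 0) {p | p.2 ≠ 0} := by
  simp only [w_rest_eq_potPoly]
  have hu : ContinuousOn (fun p : ℝ × ℝ => (rho1 μ p.1 p.2)⁻¹) {p | p.2 ≠ 0} := by
    refine ContinuousOn.inv₀ (by unfold rho1; fun_prop) fun p (hp : p.2 ≠ 0) => ?_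
    exact (Real.sqrt_pos.2 (by positivity)).ne'
  have hv : ContinuousOn (fun p : ℝ × ℝ => (rho2 μ p.1 p.2)⁻¹) {p | p.2 ≠ 0} := by
    refine ContinuousOn.inv₀ (by unfold rho2; fun_prop) fun p (hp : p.2 ≠ 0) => ?_
    exact (Real.sqrt_pos.2 (by positivity)).ne'
  unfold potPoly
  fun_prop

/-- A rectangle near `L₄`, with the signs of the gradient prescribed at its top left and its bottom
right vertex. -/
structure OutwardRectangle (a b c d : ℝ) : Prop where
  left_mem : a ∈ Set.Icc (0.4999 : ℝ) 0.5001
  right_mem : b ∈ Set.Icc (0.4999 : ℝ) 0.5001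
  bottom_mem : c ∈ Set.Icc (0.866 : ℝ) 0.8661
  top_mem : d ∈ Set.Icc (0.866 : ℝ) 0.8661
  f_top_left : f (a, d) < 0
  g_top_left : 0 < g (a, d)
  f_bottom_right : 0 < f (b, c)
  g_bottom_right : g (b, c) < 0

namespace OutwardRectangle

variable {a b c d : ℝ}

/-- By monotonicity in `η`, the largest value of `f` on the left side is at the top left vertex. The
other three sides are analogous. -/
theorem f_left_neg (h : OutwardRectangle a b c d) {y : ℝ} (hy : y ∈ Set.Icc c d) :
    f (a, y) < 0 :=
  ((strictMonoOn_f_snd h.left_mem).monotoneOn ⟨h.bottom_mem.1.trans hy.1, hy.2.trans h.top_mem.2⟩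
    h.top_mem hy.2).trans_lt h.f_top_left

theorem f_right_pos (h : OutwardRectangle a b c d) {y : ℝ} (hy : y ∈ Set.Icc c d) :
    0 < f (b, y) :=
  h.f_bottom_right.trans_le ((strictMonoOn_f_snd h.right_mem).monotoneOn h.bottom_mem
    ⟨h.bottom_mem.1.trans hy.1, hy.2.trans h.top_mem.2⟩ hy.1)

theorem g_bottom_neg (h : OutwardRectangle a b c d) {x : ℝ} (hx : x ∈ Set.Icc a b) :
    g (x, c) < 0 :=
  ((strictMonoOn_g_fst h.bottom_mem).monotoneOn ⟨h.left_mem.1.trans hx.1, hx.2.trans h.right_mem.2⟩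
    h.right_mem hx.2).trans_lt h.g_bottom_right

theorem g_top_pos (h : OutwardRectangle a b c d) {x : ℝ} (hx : x ∈ Set.Icc a b) :
    0 < g (x, d) :=
  h.g_top_left.trans_le ((strictMonoOn_g_fst h.top_mem).monotoneOn h.left_mem
    ⟨h.left_mem.1.trans hx.1, hx.2.trans h.right_mem.2⟩ hx.1)

theorem exists_equilibrium (h : OutwardRectangle a b c d) (hab : a ≤ b) (hcd : c ≤ d) :
    ∃ p ∈ Set.Ioo a b ×ˢ Set.Ioo c d, f p = 0 ∧ g p = 0 := by
  have h0 : ∀ p ∈ Set.Icc a b ×ˢ Set.Icc c d, p.2 ≠ 0 := fun p hp =>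
    (lt_of_lt_of_le (by norm_num) (h.bottom_mem.1.trans hp.2.1)).ne'
  refine exists_critical_point_of_outward_gradient hab hcd
    ((continuousOn_w μES cES).mono h0) (fun p hp => ?_) (fun p hp => ?_)
    (fun y hy => h.f_left_neg hy) (fun y hy => h.f_right_pos hy)
    (fun x hx => h.g_bottom_neg hx) (fun x hx => h.g_top_pos hx)
  -- `f` and `g` unfold to `deriv`, so differentiability alone suffices.
  · exact (hasDerivAt_w_fst μES cES p.1 (h0 p hp)).differentiableAt.hasDerivAt
  · exact (hasDerivAt_w_snd μES cES p.1 (h0 p hp)).differentiableAt.hasDerivAt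

end OutwardRectangle

theorem outwardRectangle_vertices : OutwardRectangle P2.1 P1.1 P3.2 P1.2 where
  left_mem := by norm_num [P2]
  right_mem := by norm_num [P1]
  bottom_mem := by norm_num [P3]
  top_mem := by norm_num [P1]
  -- The top left vertex is `P2` and the bottom right one `P3`, definitionally; `P1` and `P4` are
  -- not needed for the signs.
  f_top_left := f_g_P2.1.2.trans (by norm_num)
  g_top_left := lt_trans (by norm_num) f_g_P2.2.1
  f_bottom_right := lt_trans (by norm_num) f_g_P3.1.1
  g_bottom_right := f_g_P3.2.2.trans (by norm_num)

/-- A rectangle of width `2 · 10⁻⁹` centred, to the digits shown, at `Z0`. To leading order the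
Hessian at `L₄` has entries `3/4`, `3√3/4 (1 - 2μ)`, `9/4` and is nearly singular along `(√3, -1)`.
The diagonal from top left to bottom right follows this direction; there the small `μ` term gives
`f` and `g` the required opposite signs. -/
theorem outwardRectangle_equilibrium :
    OutwardRectangle 0.4999970015232019 0.4999970035232019
      0.86602539964533958 0.86602540080003958 where
  left_mem := by norm_num
  right_mem := by norm_num
  bottom_mem := by norm_num
  top_mem := by norm_num
  f_top_left := f_g_topLeft.1.2
  g_top_left := f_g_topLeft.2.1
  f_bottom_right := f_g_bottomRight.1.1
  g_bottom_right := f_g_bottomRight.2.2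

theorem region_eq : region = Set.Ioo P2.1 P1.1 ×ˢ Set.Ioo P3.2 P1.2 := by
  have h : ({P1, P2, P3, P4} : Set (ℝ × ℝ)) = {P2.1, P1.1} ×ˢ {P3.2, P1.2} := by
    simp only [Set.insert_prod, Set.singleton_prod, Set.image_pair, P1, P2, P3, P4]
    grind
  rw [region, h, convexHull_prod, convexHull_pair, convexHull_pair,
    segment_eq_Icc (by norm_num [P1, P2]), segment_eq_Icc (by norm_num [P1, P3]),
    interior_prod_eq, interior_Icc, interior_Icc]

theorem mul_add_one_sub_mul_mem_Icc {a b t : ℝ} (hab : a ≤ b) (ht : t ∈ Set.Icc (0 : ℝ) 1) :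
    t * b + (1 - t) * a ∈ Set.Icc a b := by
  obtain ⟨h0, h1⟩ := ht
  constructor <;> nlinarith

theorem β1_eq (t : ℝ) : β1 t = (t * P1.1 + (1 - t) * P2.1, P1.2) := by
  ext
  · simp [β1]
  · simp [β1, P1, P2]
    ring

theorem β2_eq (t : ℝ) : β2 t = (t * P1.1 + (1 - t) * P2.1, P3.2) := by
  ext
  · simp [β2, P1, P2, P3, P4]
  · simp [β2, P3, P4]
    ring

theorem β3_eq (t : ℝ) : β3 t = (P1.1, t * P1.2 + (1 - t) * P3.2) := by
  ext
  · simp [β3, P1, P3]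
    ring
  · simp [β3]

theorem β4_eq (t : ℝ) : β4 t = (P2.1, t * P1.2 + (1 - t) * P3.2) := by
  ext
  · simp [β4, P2, P4]
    ring
  · simp [β4, P1, P2, P3, P4]

end RelRTBP

end

theorem mainTheorem1 :
    -- the values of `f` and `g` at the vertices and at `Z0`, to the stated number of digits
    (RelRTBP.f RelRTBP.P1 ∈ Set.Ico (1.124997 / 10 ^ 7 : ℝ) (1.124998 / 10 ^ 7) ∧
      RelRTBP.g RelRTBP.P1 ∈ Set.Ico (1.94854 / 10 ^ 7 : ℝ) (1.94855 / 10 ^ 7) ∧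
      -RelRTBP.f RelRTBP.P2 ∈ Set.Ico (2.22772 / 10 ^ 13 : ℝ) (2.22773 / 10 ^ 13) ∧
      RelRTBP.g RelRTBP.P2 ∈ Set.Ico (3.94516 / 10 ^ 13 : ℝ) (3.94517 / 10 ^ 13) ∧
      RelRTBP.f RelRTBP.P3 ∈ Set.Ico (4.60545 / 10 ^ 13 : ℝ) (4.60546 / 10 ^ 13) ∧
      -RelRTBP.g RelRTBP.P3 ∈ Set.Ico (7.63052 / 10 ^ 13 : ℝ) (7.63053 / 10 ^ 13) ∧
      -RelRTBP.f RelRTBP.P4 ∈ Set.Ico (1.12499 / 10 ^ 7 : ℝ) (1.12500 / 10 ^ 7) ∧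
      -RelRTBP.g RelRTBP.P4 ∈ Set.Ico (1.94855 / 10 ^ 7 : ℝ) (1.94856 / 10 ^ 7) ∧
      -RelRTBP.f RelRTBP.Z0 ∈ Set.Ico (1.14508 / 10 ^ 32 : ℝ) (1.14509 / 10 ^ 32) ∧
      -RelRTBP.g RelRTBP.Z0 ∈ Set.Ico (4.25190 / 10 ^ 32 : ℝ) (4.25191 / 10 ^ 32)) ∧
    -- the signs on the four sides
    (∀ t ∈ Set.Icc (0 : ℝ) 1, 0 < RelRTBP.g (RelRTBP.β1 t)) ∧
    (∀ t ∈ Set.Icc (0 : ℝ) 1, RelRTBP.g (RelRTBP.β2 t) < 0) ∧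
    (∀ t ∈ Set.Icc (0 : ℝ) 1, 0 < RelRTBP.f (RelRTBP.β3 t)) ∧
    (∀ t ∈ Set.Icc (0 : ℝ) 1, RelRTBP.f (RelRTBP.β4 t) < 0) ∧
    -- the equilibrium inside the region, close to the Newtonian `L₄`
    (∃ P₀ ∈ RelRTBP.region, RelRTBP.f P₀ = 0 ∧ RelRTBP.g P₀ = 0 ∧
      Real.sqrt ((P₀.1 - (1 - 2 * RelRTBP.μES) / 2) ^ 2 + (P₀.2 - Real.sqrt 3 / 2) ^ 2)
        < 1 / 10 ^ 8) := by
  have hx : RelRTBP.P2.1 ≤ RelRTBP.P1.1 := by norm_num [RelRTBP.P1, RelRTBP.P2]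
  have hy : RelRTBP.P3.2 ≤ RelRTBP.P1.2 := by norm_num [RelRTBP.P1, RelRTBP.P3]
  have hrect := RelRTBP.outwardRectangle_vertices
  obtain ⟨⟨f1, f1'⟩, g1, g1'⟩ := RelRTBP.f_g_P1
  obtain ⟨⟨f2, f2'⟩, g2, g2'⟩ := RelRTBP.f_g_P2
  obtain ⟨⟨f3, f3'⟩, g3, g3'⟩ := RelRTBP.f_g_P3
  obtain ⟨⟨f4, f4'⟩, g4, g4'⟩ := RelRTBP.f_g_P4
  obtain ⟨⟨f0, f0'⟩, g0, g0'⟩ := RelRTBP.f_g_Z0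
  refine ⟨⟨⟨f1.le, f1'⟩, ⟨g1.le, g1'⟩, ⟨by linarith, by linarith⟩, ⟨g2.le, g2'⟩, ⟨f3.le, f3'⟩,
    ⟨by linarith, by linarith⟩, ⟨by linarith, by linarith⟩, ⟨by linarith, by linarith⟩,
    ⟨by linarith, by linarith⟩, ⟨by linarith, by linarith⟩⟩,
    fun t ht => ?_, fun t ht => ?_, fun t ht => ?_, fun t ht => ?_, ?_⟩
  · rw [RelRTBP.β1_eq]
    exact hrect.g_top_pos (RelRTBP.mul_add_one_sub_mul_mem_Icc hx ht)
  · rw [RelRTBP.β2_eq]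
    exact hrect.g_bottom_neg (RelRTBP.mul_add_one_sub_mul_mem_Icc hx ht)
  · rw [RelRTBP.β3_eq]
    exact hrect.f_right_pos (RelRTBP.mul_add_one_sub_mul_mem_Icc hy ht)
  · rw [RelRTBP.β4_eq]
    exact hrect.f_left_neg (RelRTBP.mul_add_one_sub_mul_mem_Icc hy ht)
  -- The quadrilateral is `1.5 · 10⁻⁷` wide, too coarse for the distance bound, so the equilibrium
  -- is taken from the small rectangle.
  · obtain ⟨p, ⟨⟨hxl, hxr⟩, hyl, hyr⟩, hf, hg⟩ :=
      RelRTBP.outwardRectangle_equilibrium.exists_equilibrium (by norm_num) (by norm_num)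
    refine ⟨p, ?_, hf, hg, ?_⟩
    · rw [RelRTBP.region_eq]
      norm_num at hxl hxr hyl hyr
      refine ⟨⟨lt_trans ?_ hxl, hxr.trans ?_⟩, lt_trans ?_ hyl, hyr.trans ?_⟩ <;>
        norm_num [RelRTBP.P1, RelRTBP.P2, RelRTBP.P3]
    · have h3l : (1.7320508075 : ℝ) < Real.sqrt 3 := Real.lt_sqrt_of_sq_lt (by norm_num)
      have h3r : Real.sqrt 3 < (1.732050807569 : ℝ) :=
        (Real.sqrt_lt' (by norm_num)).2 (by norm_num)
      rw [Real.sqrt_lt' (by norm_num)]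
      -- The farthest points of the small rectangle give `7.2` and `4.2` after rounding up, and
      -- `7.2² + 4.2² = 69.48 < 100`.
      have h1 : |p.1 - (1 - 2 * RelRTBP.μES) / 2| ≤ 7.2 / 10 ^ 9 := by
        rw [abs_le, RelRTBP.μES]
        constructor <;> linarith
      have h2 : |p.2 - Real.sqrt 3 / 2| ≤ 4.2 / 10 ^ 9 := by
        rw [abs_le]
        constructor <;> linarith
      have h1' := sq_le_sq' (abs_le.1 h1).1 (abs_le.1 h1).2
      have h2' := sq_le_sq' (abs_le.1 h2).1 (abs_le.1 h2).2
      norm_num at h1' h2' ⊢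
      linarith
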